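/- Let $p$ be a prime number and let $(R,\mathfrak m)$ be an unramified regular local ring of mixed characteristic $p$, that is, a regular local ring of characteristic $0$ whose residue field has characteristic $p$ and with $p\notin\mathfrak m^2$. Let $S$ be an Eisenstein extension of $R$, that is, $S\cong R[X]/(f)$ as an $R$-algebra for a monic polynomial $f=X^n+a_1X^{n-1}+\dots+a_n\in R[X]$ with $n\ge 1$, all $a_k\in\mathfrak m$ and $a_n\notin\mathfrak m^2$. Let $I\subseteq R$ be an ideal and $i\ge 0$ an integer such that the prime ideal $p\mathbb Z$ belongs neither to $\operatorname{Ass}_{\mathbb Z}H^i_I(R)$ nor to $\operatorname{Ass}_{\mathbb Z}H^{i+1}_I(R)$. Then $p$ is a nonzerodivisor of $S$, and for every ideal $J\subseteq S$ with $\operatorname{rad}(J+pS)=\operatorname{rad}(IS+pS)$ the Bockstein homomorphism $$\beta^{i-1}_p\colon H^{i-1}_J(S/pS)\longrightarrow H^i_J(S/pS)$$ is zero. Here $\beta^{i-1}_p$ is the composite of the connecting homomorphism $H^{i-1}_J(S/pS)\to H^i_J(S)$ of the short exact sequence $0\to S\xrightarrow{\,p\,}S\to S/pS\to 0$ with the map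 $H^i_J(S)\to H^i_J(S/pS)$ induced by $S\to S/pS$; for $i=0$ its source $H^{-1}_J(S/pS)$ is $0$ and there is nothing to prove. -/

import Mathlib

open CategoryTheory

universe u

namespace LocalCohomologyExt

variable {A : Type u} [CommRing A]

/-- The canonical surjection `A ⧸ J ^ t ⟶ A ⧸ J ^ s` for `s ≤ t`. -/
noncomputable def powProj (J : Ideal A) {s t : ℕ} (h : s ≤ t) :
    ModuleCat.of A (A ⧸ J ^ t) ⟶ ModuleCat.of A (A ⧸ J ^ s) :=
  ModuleCat.ofHom (Submodule.factor (Ideal.pow_le_pow_right h))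

/-- The transition map `Ext^n(A ⧸ J ^ s, M) → Ext^n(A ⧸ J ^ t, M)` for `s ≤ t`, induced by the
canonical surjection `A ⧸ J ^ t ⟶ A ⧸ J ^ s`. -/
noncomputable def transition (J : Ideal A) (M : ModuleCat.{u} A) (n : ℕ) (s t : ℕ) (h : s ≤ t) :
    Abelian.Ext.{u} (ModuleCat.of A (A ⧸ J ^ s)) M n →ₗ[A]
      Abelian.Ext.{u} (ModuleCat.of A (A ⧸ J ^ t)) M n :=
  (Abelian.Ext.mk₀ (powProj J h)).precompOfLinear A M (zero_add n)

/-- The `n`-th local cohomology module `H^n_J(M) = colim_t Ext^n(A ⧸ J ^ t, M)`.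

This is the direct limit which Mathlib's `localCohomology` uses; it is taken here with the
`Ext` modules `CategoryTheory.Abelian.Ext`, for which Mathlib has connecting homomorphisms. -/
abbrev H (J : Ideal A) (n : ℕ) (M : ModuleCat.{u} A) : Type u :=
  Module.DirectLimit (fun t : ℕ => Abelian.Ext.{u} (ModuleCat.of A (A ⧸ J ^ t)) M n)
    (transition J M n)

/-- The map `H^n_J(M) → H^m_J(N)` obtained, in the direct limit, from the Yoneda product with a
class `β ∈ Ext^k(M, N)`, where `n + k = m`. -/
noncomputable def comp (J : Ideal A) {M N : ModuleCat.{u} A} {k : ℕ} (β : Abelian.Ext.{u} M N k)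
    {n m : ℕ} (h : n + k = m) : H J n M →ₗ[A] H J m N :=
  Module.DirectLimit.map (fun _ => β.postcompOfLinear A _ h) (fun s t hst => by
    ext x
    simpa [transition] using
      (Abelian.Ext.comp_assoc (Abelian.Ext.mk₀ (powProj J hst)) x β (zero_add n) h (by omega)))

/-- The map `H^n_J(M) → H^n_J(N)` induced by a linear map `M → N`. -/
noncomputable def map (J : Ideal A) (n : ℕ) {M N : ModuleCat.{u} A} (φ : M ⟶ N) :
    H J n M →ₗ[A] H J n N :=
  comp J (Abelian.Ext.mk₀ φ) (add_zero n)

/-- The connecting homomorphism `H^n_J(X₃) → H^m_J(X₁)`, where `m = n + 1`, of a short exact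
sequence `0 → X₁ → X₂ → X₃ → 0`. -/
noncomputable def connecting (J : Ideal A) {X : ShortComplex (ModuleCat.{u} A)}
    (hX : X.ShortExact) {n m : ℕ} (h : n + 1 = m) : H J n X.X₃ →ₗ[A] H J m X.X₁ :=
  comp J hX.extClass h

/-- The quotient map `A ⟶ A ⧸ uA`. -/
noncomputable def quotMap (u : A) :
    ModuleCat.of A A ⟶ ModuleCat.of A (A ⧸ Ideal.span {u}) :=
  ModuleCat.ofHom (Submodule.mkQ (Ideal.span {u}))

/-- The sequence `A → A → A ⧸ uA`, the first map being multiplication by `u`. -/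
noncomputable abbrev mulComplex (u : A) : ShortComplex (ModuleCat.{u} A) where
  X₁ := ModuleCat.of A A
  X₂ := ModuleCat.of A A
  X₃ := ModuleCat.of A (A ⧸ Ideal.span {u})
  f := ModuleCat.ofHom (LinearMap.mulLeft A u)
  g := quotMap u
  zero := by
    ext
    simp [quotMap]

theorem mulComplex_shortExact {u : A} (hu : u ∈ nonZeroDivisors A) :
    (mulComplex u).ShortExact where
  exact := by
    rw [ShortComplex.moduleCat_exact_iff]
    intro (x : A) hx
    have hx' : Submodule.mkQ (Ideal.span {u}) x = 0 := hx
    rw [Submodule.mkQ_apply, Submodule.Quotient.mk_eq_zero, Ideal.mem_span_singleton'] at hx'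
    obtain ⟨y, hy⟩ := hx'
    exact ⟨y, (mul_comm u y).trans hy⟩
  mono_f := by
    refine (ModuleCat.mono_iff_injective _).2 fun (x : A) (y : A) (hxy : u * x = u * y) => ?_
    exact (mul_cancel_left_mem_nonZeroDivisors hu).1 hxy
  epi_g := (ModuleCat.epi_iff_surjective _).2 (Submodule.mkQ_surjective _)

/-- The Bockstein homomorphism `H^j_J(A ⧸ uA) → H^i_J(A ⧸ uA)`, where `i = j + 1` and `u` is a
nonzerodivisor: the connecting homomorphism `H^j_J(A ⧸ uA) → H^i_J(A)` of the sequence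
`0 → A → A → A ⧸ uA → 0`, followed by the map induced by `A → A ⧸ uA`. -/
noncomputable def bockstein (J : Ideal A) (u : A) (hu : u ∈ nonZeroDivisors A) {j i : ℕ}
    (h : j + 1 = i) :
    H J j (ModuleCat.of A (A ⧸ Ideal.span {u})) →ₗ[A]
      H J i (ModuleCat.of A (A ⧸ Ideal.span {u})) :=
  map J i (quotMap u) ∘ₗ connecting J (mulComplex_shortExact hu) h

end LocalCohomologyExt

/-- `S` is an Eisenstein extension of the local ring `(R, 𝔪)`: `S ≅ R[X]/(f)` for a monic `f` of
positive degree whose lower coefficients are in `𝔪` and whose constant term is not in `𝔪 ^ 2`. -/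
def IsEisensteinExtension (R S : Type u) [CommRing R] [IsLocalRing R] [CommRing S]
    [Algebra R S] : Prop :=
  ∃ f : Polynomial R, f.Monic ∧ 0 < f.natDegree ∧
    f.IsEisensteinAt (IsLocalRing.maximalIdeal R) ∧ Nonempty (AdjoinRoot f ≃ₐ[R] S)

/-! The ring `R` is a domain of characteristic `0` and `S` is free of finite rank over it, so `p` is
a nonzerodivisor of `S`. By flat base change (`extRestr_bijective`), `Ext` over `S` from powers of
`IS` into `S` is `Ext` over `R` from powers of `I` into a finite sum of copies of `R`. Hence
`p`-torsion-freeness passes from `H^i_I(R)` to `H^i_{IS}(S)` (`res_eventually_eq_zero_of_free`). The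
connecting map out of `H^{i-1}_{IS}(S/pS)` has image killed by `p`, so it vanishes, and so does the
Bockstein for `IS`.

To reach `J`, put `K = rad(J + pS) = rad(IS + pS)`. Since `S/pS` is `p`-power torsion, its local
cohomology for `J`, `K` and `IS` agrees (`res_eventually_bijective`). The Bockstein is the Yoneda
product with one class in `Ext^1(S/pS, S/pS)`, so it commutes with these identifications
(`bockstein_eq_zero`). -/

namespace IsRegularLocalRing

/-! ### Regular local rings are domains. -/

open IsLocalRing

/-- The class of `x` is nonzero in the cotangent space, hence part of a basis. By Nakayama, lifts of
the basis generate `𝔪`, and the generator `x` dies in the quotient. -/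
theorem spanFinrank_maximalIdeal_quotient_add_one_le {R : Type*} [CommRing R] [IsLocalRing R]
    [IsNoetherianRing R] {x : R} [IsLocalRing (R ⧸ Ideal.span {x})] (hx : x ∈ maximalIdeal R)
    (hx' : x ∉ maximalIdeal R ^ 2) :
    (maximalIdeal (R ⧸ Ideal.span {x})).spanFinrank + 1 ≤ (maximalIdeal R).spanFinrank := by
  classical
  set m := maximalIdeal R
  set v : CotangentSpace R := m.toCotangent ⟨x, hx⟩ with hv
  have hv0 : v ≠ 0 := fun h => hx' ((m.toCotangent_eq_zero _).1 h)
  have hli : LinearIndepOn (ResidueField R) id ({v} : Set (CotangentSpace R)) :=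
    LinearIndepOn.singleton hv0
  obtain ⟨b, hb, hvb, hspan, hbli⟩ := exists_linearIndepOn_id_extension hli (Set.subset_univ _)
  have hbspan : Submodule.span (ResidueField R) b = ⊤ := by
    rw [eq_top_iff]; intro y _; exact hspan (Set.mem_univ y)
  have hbfin : b.Finite := hbli.setFinite
  have hcard : b.ncard = m.spanFinrank := by
    rw [spanFinrank_maximalIdeal_eq_finrank_cotangentSpace]
    have B : Module.Basis b (ResidueField R) (CotangentSpace R) :=
      Module.Basis.mk hbli (by simp [hbspan])
    rw [Module.finrank_eq_nat_card_basis B, Nat.card_coe_set_eq]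
  let σ : CotangentSpace R → m := Function.surjInv m.toCotangent_surjective
  have hσ : ∀ w, m.toCotangent (σ w) = w := Function.surjInv_eq _
  set T : Set m := insert ⟨x, hx⟩ (σ '' (b \ {v}))
  have himg : m.toCotangent '' T = b := by
    rw [Set.image_insert_eq, Set.image_image]
    simp only [hσ, Set.image_id', ← hv]
    rw [Set.insert_sdiff_singleton, Set.insert_eq_of_mem (hvb rfl)]
  have hT : Submodule.span R T = ⊤ := by
    rw [← CotangentSpace.span_image_eq_top_iff]
    exact (congrArg _ himg).trans hbspan
  have hTm : Ideal.span ((↑) '' T : Set R) = m := by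
    have := congrArg (Submodule.map m.subtype) hT
    rw [Submodule.map_span, Submodule.map_top, Submodule.range_subtype] at this
    exact this
  have hmax : maximalIdeal (R ⧸ Ideal.span {x}) = m.map (Ideal.Quotient.mk (Ideal.span {x})) := by
    refine (IsLocalRing.eq_maximalIdeal ?_).symm
    refine (Ideal.map_eq_top_or_isMaximal_of_surjective _ Ideal.Quotient.mk_surjective
      (maximalIdeal.isMaximal R)).resolve_left fun h => ?_
    have h2 := congrArg (Ideal.comap (Ideal.Quotient.mk (Ideal.span {x}))) h
    rw [Ideal.comap_map_of_surjective _ Ideal.Quotient.mk_surjective, Ideal.comap_top,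
      ← RingHom.ker_eq_comap_bot, Ideal.mk_ker,
      sup_eq_left.2 ((Ideal.span_singleton_le_iff_mem _).2 hx)] at h2
    exact (maximalIdeal.isMaximal R).ne_top h2
  set q := Ideal.Quotient.mk (Ideal.span {x})
  have hgen : maximalIdeal (R ⧸ Ideal.span {x}) =
      Ideal.span (q '' ((↑) '' (σ '' (b \ {v})) : Set R)) := by
    rw [hmax, ← congrArg (Ideal.map q) hTm, Ideal.map_span, Set.image_insert_eq, Set.image_insert_eq]
    have : q x = 0 := Ideal.Quotient.eq_zero_iff_mem.2 (Ideal.mem_span_singleton_self x)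
    simp only [this, Ideal.span_insert_zero]
  rw [hgen, ← hcard]
  have hf : (b \ {v}).Finite := hbfin.sdiff
  have h1 := Submodule.spanFinrank_span_le_ncard_of_finite (R := R ⧸ Ideal.span {x})
    (s := q '' ((↑) '' (σ '' (b \ {v})) : Set R)) (((hf.image _).image _).image _)
  have h2 : (q '' ((↑) '' (σ '' (b \ {v})) : Set R)).ncard ≤ (b \ {v}).ncard :=
    (Set.ncard_image_le ((hf.image _).image _)).trans
      ((Set.ncard_image_le (hf.image _)).trans (Set.ncard_image_le hf))
  have h3 := Set.ncard_sdiff_singleton_add_one (hvb rfl) hbfin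
  calc _ ≤ (b \ {v}).ncard + 1 := Nat.add_le_add_right (h1.trans h2) 1
    _ = b.ncard := h3

/-- The quotient of a regular local ring by an element of `𝔪 \ 𝔪 ^ 2` is a regular local ring of
smaller embedding dimension. -/
theorem quotient_span_singleton {R : Type*} [CommRing R] [IsRegularLocalRing R] {x : R}
    (hx : x ∈ maximalIdeal R) (hx' : x ∉ maximalIdeal R ^ 2) :
    IsRegularLocalRing (R ⧸ Ideal.span {x}) ∧
      ∀ [IsLocalRing (R ⧸ Ideal.span {x})],
        (maximalIdeal (R ⧸ Ideal.span {x})).spanFinrank < (maximalIdeal R).spanFinrank := by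
  have hne : Ideal.span {x} ≠ ⊤ := fun h =>
    (maximalIdeal.isMaximal R).ne_top (top_le_iff.1 (h ▸ (Ideal.span_singleton_le_iff_mem _).2 hx))
  have : Nontrivial (R ⧸ Ideal.span {x}) := Ideal.Quotient.nontrivial_iff.2 hne
  have : IsLocalRing (R ⧸ Ideal.span {x}) :=
    .of_surjective' (Ideal.Quotient.mk _) Ideal.Quotient.mk_surjective
  have key := spanFinrank_maximalIdeal_quotient_add_one_le hx hx'
  refine ⟨of_spanFinrank_maximalIdeal_le _ ?_, fun {_} => by omega⟩
  -- Cutting by one element lowers the dimension by at most one, while by `key` the embedding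
  -- dimension drops by at least one.
  have h1 := ringKrullDim_le_ringKrullDim_quotient_add_card {x}
    (by simpa [IsLocalRing.ringJacobson_eq_maximalIdeal] using hx)
  rw [← IsRegularLocalRing.spanFinrank_maximalIdeal (R := R)] at h1
  rw [Finset.coe_singleton, Finset.card_singleton, Nat.cast_one] at h1
  have h2 : (((maximalIdeal (R ⧸ Ideal.span {x})).spanFinrank + 1 : ℕ) : WithBot ℕ∞) ≤
      ringKrullDim (R ⧸ Ideal.span {x}) + 1 := (Nat.cast_le.2 key).trans h1
  push_cast at h2
  exact ENat.WithBot.add_le_add_one_right_iff.1 h2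

/-- A regular local ring is a domain. -/
theorem isDomain (R : Type*) [CommRing R] [IsRegularLocalRing R] : IsDomain R := by
  induction hd : (maximalIdeal R).spanFinrank using Nat.strong_induction_on generalizing R with
  | _ d ih =>
  by_cases hm : maximalIdeal R = ⊥
  · exact (IsLocalRing.isField_iff_maximalIdeal_eq.2 hm).isDomain
  have hsq : ¬ maximalIdeal R ≤ maximalIdeal R ^ 2 := fun h => hm <| by
    refine Submodule.eq_bot_of_le_smul_of_le_jacobson_bot (maximalIdeal R) _
      (IsNoetherian.noetherian _) ?_ (IsLocalRing.maximalIdeal_le_jacobson _)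
    rwa [smul_eq_mul, ← pow_two]
  by_cases hmin : maximalIdeal R ∈ minimalPrimes R
  · have h0 : ringKrullDim R = 0 := by
      rw [← IsLocalRing.maximalIdeal_height_eq_ringKrullDim, Ideal.height_eq_zero_iff.2 hmin]
      rfl
    rw [← IsRegularLocalRing.spanFinrank_maximalIdeal] at h0
    have h0' : (maximalIdeal R).spanFinrank = 0 := by exact_mod_cast h0
    exact absurd ((Submodule.spanFinrank_eq_zero_iff_eq_bot (IsNoetherian.noetherian _)).1 h0') hm
  -- Prime avoidance over the finitely many minimal primes; `𝔪 ^ 2` is the one member that need not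
  -- be prime.
  obtain ⟨x, hxm, hx⟩ : ∃ x ∈ maximalIdeal R, x ∉ maximalIdeal R ^ 2 ∧
      ∀ P ∈ minimalPrimes R, x ∉ P := by
    by_contra! hcon
    have := (Ideal.subset_union_prime_finite (f := id)
      ((minimalPrimes.finite_of_isNoetherianRing R).insert (maximalIdeal R ^ 2))
      (maximalIdeal R ^ 2) (maximalIdeal R ^ 2) (fun i hi h _ => ?_) (I := maximalIdeal R)).1 ?_
    · obtain ⟨P, hP | hP, hle⟩ := this
      · exact hsq (hP ▸ hle)
      · have : P.IsPrime := hP.1.1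
        have hPm : P = maximalIdeal R :=
          le_antisymm (IsLocalRing.le_maximalIdeal this.ne_top) hle
        exact hmin (hPm ▸ hP)
    · exact ((Set.mem_insert_iff.1 hi).resolve_left h).1.1
    · intro x hx
      by_cases h2 : x ∈ maximalIdeal R ^ 2
      · exact Set.mem_biUnion (Set.mem_insert _ _) h2
      · obtain ⟨P, hP, hxP⟩ := hcon x hx h2
        exact Set.mem_biUnion (Set.mem_insert_of_mem _ hP) hxP
  obtain ⟨hreg, hlt⟩ := quotient_span_singleton hxm hx.1
  have hdom : IsDomain (R ⧸ Ideal.span {x}) := ih _ (hd ▸ hlt) _ rfl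
  have hprime : (Ideal.span {x}).IsPrime := (Ideal.Quotient.isDomain_iff_prime _).1 hdom
  obtain ⟨P, hP, hPle⟩ := Ideal.exists_minimalPrimes_le (I := ⊥) (J := Ideal.span {x}) bot_le
  have hPprime : P.IsPrime := hP.1.1
  -- As `P ⊆ (x)` and `x ∉ P`, primality gives `P = xP ⊆ 𝔪P`, and Nakayama applies.
  have hP0 : P = ⊥ := by
    refine Submodule.eq_bot_of_le_smul_of_le_jacobson_bot (maximalIdeal R) _
      (IsNoetherian.noetherian _) (fun y hy => ?_) (IsLocalRing.maximalIdeal_le_jacobson _)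
    obtain ⟨z, rfl⟩ := Ideal.mem_span_singleton'.1 (hPle hy)
    rw [mul_comm]
    exact Submodule.smul_mem_smul hxm
      ((hPprime.mem_or_mem hy).resolve_right (hx.2 P hP))
  have : (⊥ : Ideal R).IsPrime := hP0 ▸ hPprime
  exact IsDomain.of_bot_isPrime R

end IsRegularLocalRing

/-! ### Power torsion modules and their injective hulls of torsion type. -/

section Torsion

variable {A : Type u} [CommRing A]

/-- A module is `π`-power torsion if every element is killed by a power of `π`. -/
def Module.IsPowTorsion (π : A) (M : Type*) [AddCommGroup M] [Module A M] : Prop :=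
  ∀ m : M, ∃ k : ℕ, π ^ k • m = 0

theorem Module.IsPowTorsion.of_surjective {π : A} {M N : Type*} [AddCommGroup M] [Module A M]
    [AddCommGroup N] [Module A N] (h : Module.IsPowTorsion π M) (f : M →ₗ[A] N)
    (hf : Function.Surjective f) : Module.IsPowTorsion π N := by
  intro n
  obtain ⟨m, rfl⟩ := hf n
  obtain ⟨k, hk⟩ := h m
  exact ⟨k, by rw [← map_smul, hk, map_zero]⟩

/-- The submodule of elements killed by a power of `π`. -/
def Submodule.powTorsion (π : A) (M : Type*) [AddCommGroup M] [Module A M] : Submodule A M :=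
  Submodule.torsion' A M (Submonoid.powers π)

theorem Submodule.mem_powTorsion {π : A} {M : Type*} [AddCommGroup M] [Module A M] {m : M} :
    m ∈ Submodule.powTorsion π M ↔ ∃ k : ℕ, π ^ k • m = 0 := by
  rw [Submodule.powTorsion, Submodule.mem_torsion'_iff]
  constructor
  · rintro ⟨⟨_, k, rfl⟩, h⟩
    exact ⟨k, h⟩
  · rintro ⟨k, h⟩
    exact ⟨⟨_, k, rfl⟩, h⟩

theorem Submodule.isPowTorsion_powTorsion (π : A) (M : Type*) [AddCommGroup M] [Module A M] :
    Module.IsPowTorsion π (Submodule.powTorsion π M) := by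
  rintro ⟨m, hm⟩
  obtain ⟨k, hk⟩ := Submodule.mem_powTorsion.1 hm
  exact ⟨k, Subtype.ext hk⟩

/-- A finitely generated `π`-power torsion module is killed by a single power of `π`. -/
theorem Module.IsPowTorsion.exists_pow_smul_eq_zero_of_fg {π : A} {M : Type*} [AddCommGroup M]
    [Module A M] (h : Module.IsPowTorsion π M) {N : Submodule A M} (hN : N.FG) :
    ∃ k : ℕ, ∀ m ∈ N, π ^ k • m = 0 := by
  classical
  obtain ⟨s, rfl⟩ := hN
  choose k hk using h
  refine ⟨s.sup k, fun m hm => ?_⟩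
  have : Submodule.span A (s : Set M) ≤ LinearMap.ker (LinearMap.lsmul A M (π ^ s.sup k)) := by
    refine Submodule.span_le.2 fun x hx => ?_
    obtain ⟨c, hc⟩ := Nat.exists_eq_add_of_le (Finset.le_sup (f := k) hx)
    change π ^ s.sup k • x = 0
    rw [hc, pow_add, mul_comm, mul_smul, hk, smul_zero]
  exact this hm

/-- Over a Noetherian ring, the `π`-power torsion of an injective module is injective. -/
theorem Module.Injective.powTorsion [IsNoetherianRing A] (π : A) {E : Type u} [AddCommGroup E]
    [Module A E] (hE : Module.Injective A E) :
    Module.Injective A (Submodule.powTorsion π E) := by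
  refine Module.Baer.injective fun I g => ?_
  obtain ⟨a, ha⟩ := (Submodule.isPowTorsion_powTorsion π E).exists_pow_smul_eq_zero_of_fg
    (N := LinearMap.range g) (by
      rw [LinearMap.range_eq_map]
      exact (IsNoetherian.noetherian (⊤ : Submodule A I)).map g)
  -- Artin–Rees: `I ∩ π^(k+a)A ⊆ π^a I`, which `g` kills. So `g` factors through the image of `I` in
  -- `A ⧸ π^(k+a)A`, and any extension from there to `E` has power torsion values.
  obtain ⟨k, hk⟩ := Ideal.exists_pow_inf_eq_pow_smul (Ideal.span {π}) (I : Submodule A A)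
  have hAR : ∀ x (hx : x ∈ I), π ^ (k + a) ∣ x → g ⟨x, hx⟩ = 0 := by
    rintro x hx ⟨y, hy⟩
    have h1 : x ∈ Ideal.span {π} ^ (k + a) • (⊤ : Submodule A A) ⊓ I := by
      refine ⟨?_, hx⟩
      rw [hy, ← smul_eq_mul]
      exact Submodule.smul_mem_smul (Ideal.pow_mem_pow (Ideal.mem_span_singleton_self π) _) trivial
    rw [hk _ (Nat.le_add_right k a), Nat.add_sub_cancel_left, Ideal.span_singleton_pow,
      Submodule.ideal_span_singleton_smul] at h1
    obtain ⟨z, hz, rfl⟩ := h1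
    have : (⟨π ^ a • z, hx⟩ : I) = π ^ a • ⟨z, hz.2⟩ := rfl
    refine (congrArg g this).trans ?_
    rw [map_smul]
    exact ha _ ⟨_, rfl⟩
  let P : Ideal A := Ideal.span {π ^ (k + a)}
  let f : (I ⧸ Submodule.comap I.subtype P) →ₗ[A] (A ⧸ P) :=
    Submodule.mapQ _ _ I.subtype le_rfl
  have hf : Function.Injective f := by
    rw [← LinearMap.ker_eq_bot, Submodule.ker_mapQ]
    simp
  let g' : (I ⧸ Submodule.comap I.subtype P) →ₗ[A] E :=
    Submodule.liftQ _ ((Submodule.powTorsion π E).subtype ∘ₗ g) fun x hx => by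
      rw [LinearMap.mem_ker, LinearMap.comp_apply]
      rw [hAR x x.2 (Ideal.mem_span_singleton.1 hx), map_zero]
  obtain ⟨h, hh⟩ := hE.out f hf g'
  refine ⟨(h ∘ₗ P.mkQ).codRestrict _ fun c => Submodule.mem_powTorsion.2 ⟨k + a, ?_⟩,
    fun x hx => Subtype.ext ?_⟩
  · rw [← map_smul, LinearMap.comp_apply]
    have : P.mkQ (π ^ (k + a) • c) = 0 := by
      rw [Submodule.mkQ_apply, Submodule.Quotient.mk_eq_zero]
      exact Ideal.mul_mem_right _ _ (Ideal.mem_span_singleton_self _)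
    rw [this, map_zero]
  · exact hh (Submodule.Quotient.mk ⟨x, hx⟩)

/-- A `π`-power torsion module over a Noetherian ring embeds into an injective module which is
again `π`-power torsion. -/
theorem ModuleCat.exists_injective_isPowTorsion [IsNoetherianRing A] (π : A) (M : ModuleCat.{u} A)
    (hM : Module.IsPowTorsion π M) :
    ∃ (E : ModuleCat.{u} A) (ι : M ⟶ E), Mono ι ∧ Injective E ∧
      Module.IsPowTorsion π E ∧ Module.IsPowTorsion π (Limits.cokernel ι : ModuleCat.{u} A) := by
  let E := Injective.under M
  let ι : M ⟶ E := Injective.ι M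
  have hE : Module.Injective A E := by
    have : Injective (ModuleCat.of A E) := inferInstanceAs (Injective (Injective.under M))
    exact Module.injective_module_of_injective_object A E
  have hι : Function.Injective ι := (ModuleCat.mono_iff_injective ι).1 inferInstance
  let Γ := ModuleCat.of A (Submodule.powTorsion π E)
  let f : M ⟶ Γ := ModuleCat.ofHom (ι.hom.codRestrict _ fun m => by
    obtain ⟨k, hk⟩ := hM m
    exact Submodule.mem_powTorsion.2 ⟨k, by rw [← map_smul, hk, map_zero]⟩)
  have : Mono f := (ModuleCat.mono_iff_injective f).2 fun x y h => hι (congrArg Subtype.val h)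
  have : Injective Γ := by
    have := hE.powTorsion π
    exact Module.injective_object_of_injective_module A _
  have hΓ : Module.IsPowTorsion π Γ := Submodule.isPowTorsion_powTorsion π E
  refine ⟨Γ, f, ‹_›, ‹_›, hΓ, ?_⟩
  exact hΓ.of_surjective (Limits.cokernel.π f).hom
    ((ModuleCat.epi_iff_surjective (Limits.cokernel.π f)).1 inferInstance)

end Torsion

/-! ### Changing the ideal for power torsion coefficients. -/

namespace LocalCohomologyExt

open Abelian

variable {A : Type u} [CommRing A]

/-- The canonical surjection `A ⧸ P ⟶ A ⧸ Q` for ideals `P ≤ Q`. -/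
noncomputable def quotFactor {P Q : Ideal A} (h : P ≤ Q) :
    ModuleCat.of A (A ⧸ P) ⟶ ModuleCat.of A (A ⧸ Q) :=
  ModuleCat.ofHom (Submodule.factor h)

theorem quotFactor_comp {P Q T : Ideal A} (h : P ≤ Q) (h' : Q ≤ T) :
    quotFactor h ≫ quotFactor h' = quotFactor (h.trans h') := by
  ext
  rfl

instance {P Q : Ideal A} (h : P ≤ Q) : Epi (quotFactor h) :=
  (ModuleCat.epi_iff_surjective _).2 (Submodule.factor_surjective h)

/-- The map `Ext^n(A ⧸ Q, M) → Ext^n(A ⧸ P, M)` for ideals `P ≤ Q`. -/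
noncomputable def res {P Q : Ideal A} (h : P ≤ Q) {M : ModuleCat.{u} A} {n : ℕ}
    (x : Ext.{u} (ModuleCat.of A (A ⧸ Q)) M n) : Ext.{u} (ModuleCat.of A (A ⧸ P)) M n :=
  (Ext.mk₀ (quotFactor h)).comp x (zero_add n)

theorem transition_apply (J : Ideal A) (M : ModuleCat.{u} A) (n s t : ℕ) (h : s ≤ t)
    (x : Ext.{u} (ModuleCat.of A (A ⧸ J ^ s)) M n) :
    transition J M n s t h x = res (Ideal.pow_le_pow_right h) x :=
  rfl

section res

variable {P Q T : Ideal A} (h : P ≤ Q) {M N : ModuleCat.{u} A} {n : ℕ}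

theorem res_res (h' : Q ≤ T) (x : Ext.{u} (ModuleCat.of A (A ⧸ T)) M n) :
    res h (res h' x) = res (h.trans h') x := by
  rw [res, res, res, Ext.mk₀_comp_mk₀_assoc, quotFactor_comp]

theorem res_refl (x : Ext.{u} (ModuleCat.of A (A ⧸ P)) M n) : res le_rfl x = x := by
  have : quotFactor (le_refl P) = 𝟙 _ := by
    ext
    rfl
  rw [res, this, Ext.mk₀_id_comp]

@[simp]
theorem res_zero : res h (0 : Ext.{u} (ModuleCat.of A (A ⧸ Q)) M n) = 0 := by
  simp [res]

@[simp]
theorem res_sub (x y : Ext.{u} (ModuleCat.of A (A ⧸ Q)) M n) :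
    res h (x - y) = res h x - res h y := by
  rw [sub_eq_add_neg, sub_eq_add_neg, res, Ext.comp_add, Ext.comp_neg]
  rfl

theorem res_comp {k m : ℕ} (x : Ext.{u} (ModuleCat.of A (A ⧸ Q)) M n) (β : Ext.{u} M N k)
    (hm : n + k = m) : res h (x.comp β hm) = (res h x).comp β hm :=
  (Ext.comp_assoc _ _ _ (zero_add n) hm (by omega)).symm

theorem res_mk₀ (f : ModuleCat.of A (A ⧸ Q) ⟶ M) :
    res h (Ext.mk₀ f) = Ext.mk₀ (quotFactor h ≫ f) :=
  Ext.mk₀_comp_mk₀ _ _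

end res

/-- This rests on `K^(a(t+b)) ⊆ (J + πA)^(t+b) ⊆ J^t + π^b A`. -/
theorem pow_smul_eq_zero_of_isPowTorsion {π : A} {J K : Ideal A} {a : ℕ}
    (hK : K ^ a ≤ J ⊔ Ideal.span {π}) {M : Type*} [AddCommGroup M] [Module A M] {m : M} {t b : ℕ}
    (hJ : ∀ c ∈ J ^ t, c • m = 0) (hπ : π ^ b • m = 0) :
    ∀ c ∈ K ^ (a * (t + b)), c • m = 0 := by
  intro c hc
  rw [pow_mul] at hc
  have h1 := Ideal.sup_pow_add_le_pow_sup_pow (Ideal.pow_right_mono hK _ hc)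
  rw [Ideal.span_singleton_pow] at h1
  obtain ⟨x, hx, y, hy, rfl⟩ := Submodule.mem_sup.1 h1
  obtain ⟨z, rfl⟩ := Ideal.mem_span_singleton'.1 hy
  rw [add_smul, hJ x hx, mul_smul, hπ, smul_zero, add_zero]

/-- For ideals `J ≤ K` of a Noetherian ring with `K ≤ rad (J + πA)`, the map
`H^n_K(M) → H^n_J(M)` is bijective when `M` is `π`-power torsion. -/
theorem res_eventually_bijective [IsNoetherianRing A] {π : A} {J K : Ideal A} (hJK : J ≤ K) {a : ℕ}
    (hK : K ^ a ≤ J ⊔ Ideal.span {π}) (n : ℕ) (M : ModuleCat.{u} A)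
    (hM : Module.IsPowTorsion π M) :
    (∀ (t : ℕ) (x : Ext.{u} (ModuleCat.of A (A ⧸ J ^ t)) M n),
      ∃ (s : ℕ) (hs : t ≤ s) (y : Ext.{u} (ModuleCat.of A (A ⧸ K ^ s)) M n),
        res (Ideal.pow_right_mono hJK s) y = res (Ideal.pow_le_pow_right hs) x) ∧
    (∀ (t : ℕ) (y : Ext.{u} (ModuleCat.of A (A ⧸ K ^ t)) M n),
      res (Ideal.pow_right_mono hJK t) y = 0 →
        ∃ (s : ℕ) (hs : t ≤ s), res (Ideal.pow_le_pow_right (I := K) hs) y = 0) := by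
  -- Dimension shifting along embeddings into power torsion injectives, whose cokernels are again
  -- power torsion. In degree zero, a map out of a cyclic module is the image of `1`.
  induction n generalizing M with
  | zero =>
    refine ⟨fun t x => ?_, fun t y hy => ⟨t, le_rfl, ?_⟩⟩
    · obtain ⟨f, rfl⟩ := (Ext.mk₀_bijective _ _).2 x
      have hJ : ∀ c ∈ J ^ t, c • f.hom (Submodule.Quotient.mk 1) = 0 := fun c hc => by
        rw [← map_smul, ← Submodule.Quotient.mk_smul, smul_eq_mul, mul_one,
          (Submodule.Quotient.mk_eq_zero _).2 hc, map_zero]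
      obtain ⟨b, hb⟩ := hM (f.hom (Submodule.Quotient.mk 1))
      have hzero := pow_smul_eq_zero_of_isPowTorsion hK hJ hb
      have hle : a * (t + b) ≤ t + a * (t + b) := Nat.le_add_left _ _
      let g : ModuleCat.of A (A ⧸ K ^ (t + a * (t + b))) ⟶ M :=
        ModuleCat.ofHom (Submodule.liftQ _
          (LinearMap.toSpanSingleton A M (f.hom (Submodule.Quotient.mk 1)))
          fun c hc => hzero c (Ideal.pow_le_pow_right hle hc))
      refine ⟨t + a * (t + b), Nat.le_add_right _ _, Ext.mk₀ g, ?_⟩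
      rw [res_mk₀, res_mk₀]
      congr 1
      ext
      exact one_smul _ _
    · obtain ⟨f, rfl⟩ := (Ext.mk₀_bijective _ _).2 y
      rw [res_mk₀, Ext.mk₀_eq_zero_iff] at hy
      rw [res_refl, Ext.mk₀_eq_zero_iff]
      rwa [← cancel_epi (quotFactor (Ideal.pow_right_mono hJK t)), Limits.comp_zero]
  | succ n ih =>
    obtain ⟨E, ι, _, _, hE, hQ⟩ := ModuleCat.exists_injective_isPowTorsion π M hM
    let S := ShortComplex.mk ι (Limits.cokernel.π ι) (Limits.cokernel.condition ι)
    have hS : S.ShortExact := { exact := ShortComplex.exact_cokernel ι }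
    have lift : ∀ (P : Ideal A) (x : Ext.{u} (ModuleCat.of A (A ⧸ P)) M (n + 1)),
        ∃ y : Ext.{u} (ModuleCat.of A (A ⧸ P)) S.X₃ n, y.comp hS.extClass rfl = x := fun P x =>
      Ext.covariant_sequence_exact₁ (S := S) _ hS x (Ext.eq_zero_of_injective _) rfl
    refine ⟨fun t x => ?_, fun t x hx => ?_⟩
    · obtain ⟨y, rfl⟩ := lift _ x
      obtain ⟨s, hs, z, hz⟩ := (ih S.X₃ hQ).1 t y
      exact ⟨s, hs, z.comp hS.extClass rfl, by rw [res_comp, res_comp, hz]⟩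
    · obtain ⟨y, rfl⟩ := lift _ x
      rw [res_comp] at hx
      obtain ⟨z, hz⟩ := Ext.covariant_sequence_exact₃ _ hS _ rfl hx
      -- The class `z` comes from `K` at a later stage. Its image in `S.X₃` then eventually equals
      -- `y`, and the connecting map kills everything coming from `S.X₂`.
      obtain ⟨s, hs, w, hw⟩ := (ih S.X₂ hE).1 t z
      obtain ⟨r, hr, h0⟩ := (ih S.X₃ hQ).2 s
        (res (Ideal.pow_le_pow_right hs) y - w.comp (Ext.mk₀ S.g) (add_zero n)) (by
          rw [res_sub, res_comp, hw, ← res_comp, hz, res_res, res_res, sub_self])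
      refine ⟨r, hs.trans hr, ?_⟩
      rw [res_sub, res_res, sub_eq_zero] at h0
      rw [res_comp, h0, res_comp, Ext.comp_assoc _ _ _ (add_zero n) (zero_add 1) rfl,
        hS.comp_extClass, Ext.comp_zero]

end LocalCohomologyExt

/-! ### Flat base change for `Ext`, and finite free extensions. -/

namespace LocalCohomologyExt

open Abelian

section BaseChange

variable {R S : Type u} [CommRing R] [CommRing S] [Algebra R S]

variable (R S) in
/-- Restriction of scalars along `R → S`. -/
noncomputable abbrev restr : ModuleCat.{u} S ⥤ ModuleCat.{u} R :=
  ModuleCat.restrictScalars.{u} (algebraMap R S)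

/-- Restriction is right adjoint to extension of scalars, which preserves monomorphisms by flatness.
-/
instance preservesInjectiveObjects_restr [Module.Flat R S] :
    (restr R S).PreservesInjectiveObjects := by
  have : (ModuleCat.extendScalars.{u} (algebraMap R S)).PreservesMonomorphisms := by
    refine ⟨fun {X Y} f hf => (ModuleCat.mono_iff_injective _).2 ?_⟩
    let S' := (restr R S).obj (ModuleCat.of S S)
    let e : S' ≃ₗ[R] S :=
      { AddEquiv.refl S with map_smul' := fun r (s : S) => (Algebra.smul_def r s).symm }
    have : Module.Flat R S' := .of_linearEquiv e
    exact Module.Flat.lTensor_preserves_injective_linearMap (M := S') f.hom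
      ((ModuleCat.mono_iff_injective f).1 hf)
  exact Functor.preservesInjectiveObjects_of_adjunction_of_preservesMonomorphisms
    (ModuleCat.extendRestrictScalarsAdj.{u} (algebraMap R S))

/-- The map `Ext_S^n(X', M) → Ext_R^n(X, M)` given by restriction of scalars and an `R`-linear map
`X → X'`. -/
noncomputable def extRestr {X : ModuleCat.{u} R} {X' : ModuleCat.{u} S}
    (e : X ⟶ (restr R S).obj X') (M : ModuleCat.{u} S) (n : ℕ) :
    Ext.{u} X' M n →+ Ext.{u} X ((restr R S).obj M) n where
  toFun x := (Ext.mk₀ e).comp (x.mapExactFunctor (restr R S)) (zero_add n)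
  map_zero' := by simp
  map_add' := by simp

theorem extRestr_apply {X : ModuleCat.{u} R} {X' : ModuleCat.{u} S}
    (e : X ⟶ (restr R S).obj X') {M : ModuleCat.{u} S} {n : ℕ} (x : Ext.{u} X' M n) :
    extRestr e M n x = (Ext.mk₀ e).comp (x.mapExactFunctor (restr R S)) (zero_add n) :=
  rfl

theorem extRestr_comp {X : ModuleCat.{u} R} {X' : ModuleCat.{u} S}
    (e : X ⟶ (restr R S).obj X') {M N : ModuleCat.{u} S} {n k m : ℕ} (x : Ext.{u} X' M n)
    (β : Ext.{u} M N k) (h : n + k = m) :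
    extRestr e N m (x.comp β h) =
      (extRestr e M n x).comp (β.mapExactFunctor (restr R S)) h := by
  rw [extRestr_apply, extRestr_apply, Ext.mapExactFunctor_comp,
    Ext.comp_assoc _ _ _ (zero_add n) h (by omega)]

/-- Flat base change for `Ext` in the first variable: if `X → X'` exhibits `X'` as the base change
of `X` along the flat map `R → S`, then `Ext_S^n(X', M) ≅ Ext_R^n(X, M)`. -/
theorem extRestr_bijective [Module.Flat R S] {X : ModuleCat.{u} R} {X' : ModuleCat.{u} S}
    (e : X ⟶ (restr R S).obj X')
    (he : ∀ M : ModuleCat.{u} S, Function.Bijective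
      fun f : X' ⟶ M => e ≫ (restr R S).map f)
    (M : ModuleCat.{u} S) (n : ℕ) : Function.Bijective (extRestr e M n) := by
  induction n generalizing M with
  | zero =>
    have h : extRestr e M 0 ∘ Ext.mk₀ = Ext.mk₀ ∘ fun f : X' ⟶ M => e ≫ (restr R S).map f := by
      ext f
      simp [extRestr_apply, Ext.mapExactFunctor_mk₀]
    rw [← Function.Bijective.of_comp_iff _ (Ext.mk₀_bijective X' M), h]
    exact (Ext.mk₀_bijective _ _).comp (he M)
  | succ n ih =>
    let ι := Injective.ι M
    let T := ShortComplex.mk ι (Limits.cokernel.π ι) (Limits.cokernel.condition ι)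
    have hT : T.ShortExact := { exact := ShortComplex.exact_cokernel ι }
    have hT' := hT.map_of_exact (restr R S)
    have hinj : Injective T.X₂ := inferInstanceAs (Injective (Injective.under M))
    have hinj' : Injective (T.map (restr R S)).X₂ :=
      Functor.PreservesInjectiveObjects.injective_obj (F := restr R S) hinj
    have hδ : ∀ y : Ext.{u} X' T.X₃ n, extRestr e M (n + 1) (y.comp hT.extClass rfl) =
        (extRestr e T.X₃ n y).comp hT'.extClass rfl := fun y => by
      rw [extRestr_comp, Ext.mapExactFunctor_extClass]
      rfl
    constructor
    · rw [injective_iff_map_eq_zero]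
      intro x hx
      obtain ⟨y, rfl⟩ := Ext.covariant_sequence_exact₁ (S := T) _ hT x
        (Ext.eq_zero_of_injective _) rfl
      rw [hδ] at hx
      obtain ⟨z, hz⟩ := Ext.covariant_sequence_exact₃ _ hT' _ rfl hx
      obtain ⟨w, rfl⟩ := (ih T.X₂).2 z
      have : w.comp (Ext.mk₀ T.g) (add_zero n) = y := (ih T.X₃).1 <| by
        rw [extRestr_comp, Ext.mapExactFunctor_mk₀]
        exact hz
      rw [← this, Ext.comp_assoc _ _ _ (add_zero n) (zero_add 1) rfl, hT.comp_extClass,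
        Ext.comp_zero]
    · intro x
      obtain ⟨y, rfl⟩ := Ext.covariant_sequence_exact₁ (S := T.map (restr R S)) _ hT' x
        (Ext.eq_zero_of_injective _) rfl
      obtain ⟨w, rfl⟩ := (ih T.X₃).2 y
      exact ⟨_, hδ w⟩

/-- The map `R ⧸ I ⟶ S ⧸ J` for `J = IS`. -/
noncomputable def quotRestr {I : Ideal R} {J : Ideal S} (h : I.map (algebraMap R S) = J) :
    ModuleCat.of R (R ⧸ I) ⟶ (restr R S).obj (ModuleCat.of S (S ⧸ J)) :=
  ModuleCat.ofHom (Y := (restr R S).obj (ModuleCat.of S (S ⧸ J)))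
    { toFun := Ideal.quotientMap J (algebraMap R S) (h ▸ Ideal.le_comap_map)
      map_add' := map_add _
      map_smul' := fun r x => by
        obtain ⟨x, rfl⟩ := Ideal.Quotient.mk_surjective x
        exact congrArg (Ideal.Quotient.mk J) (map_mul (algebraMap R S) r x) }

/-- Both kinds of maps amount to an element of `M` (the image of `1`) killed by `I`, equivalently by
`IS`. -/
theorem quotRestr_bijective {I : Ideal R} {J : Ideal S} (h : I.map (algebraMap R S) = J)
    (M : ModuleCat.{u} S) : Function.Bijective
      fun f : ModuleCat.of S (S ⧸ J) ⟶ M => quotRestr h ≫ (restr R S).map f := by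
  have hone : ∀ f : ModuleCat.of S (S ⧸ J) ⟶ M,
      (quotRestr h ≫ (restr R S).map f).hom (Submodule.Quotient.mk 1) =
        f.hom (Submodule.Quotient.mk 1) := fun f =>
    congrArg (fun s : S => f.hom (Submodule.Quotient.mk s)) (map_one (algebraMap R S))
  constructor
  · intro f g hfg
    ext
    refine (hone f).symm.trans (Eq.trans ?_ (hone g))
    exact congrArg (fun φ => φ.hom (Submodule.Quotient.mk 1)) hfg
  · intro g
    let m : M := g.hom (Submodule.Quotient.mk 1)
    have hm : J ≤ LinearMap.ker (LinearMap.toSpanSingleton S M m) := by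
      rw [← h, Ideal.map_le_iff_le_comap]
      intro r hr
      have h0 : r • (Submodule.Quotient.mk 1 : R ⧸ I) = 0 := by
        rw [← Submodule.Quotient.mk_smul, smul_eq_mul, mul_one,
          (Submodule.Quotient.mk_eq_zero _).2 hr]
      exact (map_smul g.hom r _).symm.trans ((congrArg g.hom h0).trans (map_zero g.hom))
    refine ⟨ModuleCat.ofHom (Submodule.liftQ J (LinearMap.toSpanSingleton S M m) hm), ?_⟩
    ext
    exact (hone (ModuleCat.ofHom (Submodule.liftQ J _ hm))).trans (one_smul S m)

theorem quotFactor_quotRestr {I I' : Ideal R} {J J' : Ideal S} (h : I.map (algebraMap R S) = J)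
    (h' : I'.map (algebraMap R S) = J') (hI : I ≤ I') (hJ : J ≤ J') :
    quotFactor hI ≫ quotRestr h' = quotRestr h ≫ (restr R S).map (quotFactor hJ) := by
  ext
  rfl

theorem extRestr_res {I I' : Ideal R} {J J' : Ideal S} (h : I.map (algebraMap R S) = J)
    (h' : I'.map (algebraMap R S) = J') (hI : I ≤ I') (hJ : J ≤ J') {M : ModuleCat.{u} S} {n : ℕ}
    (x : Ext.{u} (ModuleCat.of S (S ⧸ J')) M n) :
    extRestr (quotRestr h) M n (res hJ x) = res hI (extRestr (quotRestr h') M n x) := by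
  rw [extRestr_apply, extRestr_apply, res, res, Ext.mapExactFunctor_comp, Ext.mapExactFunctor_mk₀,
    Ext.mk₀_comp_mk₀_assoc, Ext.mk₀_comp_mk₀_assoc, quotFactor_quotRestr h h' hI hJ]

/-- If `S` is free of finite rank over `R` and `H^n_I(R)` has no `p`-torsion, then neither has
`H^n_{IS}(S)`. -/
theorem res_eventually_eq_zero_of_free [Module.Free R S] [Module.Finite R S] {I : Ideal R}
    {n p : ℕ}
    (hR : ∀ (t : ℕ) (x : Ext.{u} (ModuleCat.of R (R ⧸ I ^ t)) (ModuleCat.of R R) n), p • x = 0 →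
      ∃ (s : ℕ) (hs : t ≤ s), res (Ideal.pow_le_pow_right (I := I) hs) x = 0)
    (t : ℕ)
    (x : Ext.{u} (ModuleCat.of S (S ⧸ I.map (algebraMap R S) ^ t)) (ModuleCat.of S S) n)
    (hx : p • x = 0) :
    ∃ (s : ℕ) (hs : t ≤ s),
      res (Ideal.pow_le_pow_right (I := I.map (algebraMap R S)) hs) x = 0 := by
  classical
  have hmap : ∀ t, (I ^ t).map (algebraMap R S) = I.map (algebraMap R S) ^ t := fun t =>
    Ideal.map_pow _ _ _
  let b := Module.Free.chooseBasis R S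
  let X := (restr R S).obj (ModuleCat.of S S)
  let c : ∀ i, X ⟶ ModuleCat.of R R := fun i => ModuleCat.ofHom (X := X)
    { toFun := fun s : S => b.repr s i
      map_add' := fun (s s' : S) => by
        change b.repr (s + s') i = _
        rw [map_add]
        rfl
      map_smul' := fun r (s : S) => by
        change b.repr (algebraMap R S r * s) i = r * b.repr s i
        rw [← Algebra.smul_def]
        simp }
  let d : ∀ i, ModuleCat.of R R ⟶ X := fun i => ModuleCat.ofHom (Y := X)
    { toFun := fun r : R => algebraMap R S r * b i
      map_add' := fun s s' => by
        rw [map_add, add_mul]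
        rfl
      map_smul' := fun r (s : R) => by
        change algebraMap R S (r * s) * b i = algebraMap R S r * (algebraMap R S s * b i)
        rw [map_mul, mul_assoc] }
  -- This writes a class with values in `S` as the sum of its coordinates, which are classes with
  -- values in `R`.
  have hid : ∑ i, c i ≫ d i = 𝟙 X := by
    ext s
    rw [ModuleCat.hom_sum, LinearMap.sum_apply]
    change ∑ i, algebraMap R S (b.repr s i) * b i = s
    simp_rw [← Algebra.smul_def]
    exact b.sum_repr s
  set y := extRestr (quotRestr (hmap t)) _ n x with hy
  have hpy : p • y = 0 := by rw [hy, ← map_nsmul, hx, map_zero]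
  have hc : ∀ i, ∃ (s : ℕ) (hs : t ≤ s), res (Ideal.pow_le_pow_right (I := I) hs)
      (y.comp (Ext.mk₀ (c i)) (add_zero n)) = 0 := fun i => by
    refine hR t _ ?_
    rw [← Nat.cast_smul_eq_nsmul R, ← Ext.smul_comp, Nat.cast_smul_eq_nsmul R, hpy, Ext.zero_comp]
  choose s hts hs using hc
  -- A common stage for all coordinates; the summand `t` keeps it at least `t` even for an empty
  -- basis.
  refine ⟨t + Finset.univ.sup s, Nat.le_add_right _ _,
    (extRestr_bijective (quotRestr (hmap _)) (quotRestr_bijective (hmap _)) _ n).1 ?_⟩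
  rw [map_zero, extRestr_res (hmap _) (hmap t) (Ideal.pow_le_pow_right (Nat.le_add_right _ _)),
    ← hy, ← Ext.comp_mk₀_id (res _ y), ← hid, Ext.mk₀_sum, Ext.comp_sum]
  refine Finset.sum_eq_zero fun i _ => ?_
  have hle : s i ≤ t + Finset.univ.sup s :=
    (Finset.le_sup (f := s) (Finset.mem_univ i)).trans (Nat.le_add_left _ _)
  rw [← Ext.mk₀_comp_mk₀, ← Ext.comp_assoc _ _ _ (add_zero n) (zero_add 0) (by omega), ← res_comp,
    ← res_res (Ideal.pow_le_pow_right hle) (Ideal.pow_le_pow_right (hts i)), hs i, res_zero,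
    Ext.zero_comp]

end BaseChange

end LocalCohomologyExt

/-! ### Vanishing of the Bockstein in the direct limit. -/

namespace LocalCohomologyExt

open Abelian

section DirectLimit

variable {A : Type u} [CommRing A]

instance (J : Ideal A) (M : ModuleCat.{u} A) (n : ℕ) :
    DirectedSystem (fun t : ℕ => Ext.{u} (ModuleCat.of A (A ⧸ J ^ t)) M n)
      (fun s t h => transition J M n s t h) where
  map_self _ x := res_refl x
  map_map _ _ _ _ _ x := res_res _ _ x

/-- The class in `H^n_J(M)` of an element of `Ext^n(A ⧸ J ^ t, M)`. -/
noncomputable def cls (J : Ideal A) (M : ModuleCat.{u} A) (n t : ℕ) :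
    Ext.{u} (ModuleCat.of A (A ⧸ J ^ t)) M n →ₗ[A] H J n M :=
  Module.DirectLimit.of A ℕ _ (transition J M n) t

theorem exists_cls_eq {J : Ideal A} {M : ModuleCat.{u} A} {n : ℕ} (z : H J n M) :
    ∃ t x, cls J M n t x = z :=
  Module.DirectLimit.exists_of z

theorem cls_eq_zero_iff {J : Ideal A} {M : ModuleCat.{u} A} {n t : ℕ}
    {x : Ext.{u} (ModuleCat.of A (A ⧸ J ^ t)) M n} :
    cls J M n t x = 0 ↔
      ∃ (s : ℕ) (hs : t ≤ s), res (Ideal.pow_le_pow_right (I := J) hs) x = 0 := by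
  constructor
  · exact fun h => Module.DirectLimit.of.zero_exact h
  · rintro ⟨s, hs, h⟩
    have h1 : cls J M n s (transition J M n t s hs x) = cls J M n t x :=
      Module.DirectLimit.of_f
    rw [← h1, transition_apply, h, map_zero]

theorem cls_res {J : Ideal A} {M : ModuleCat.{u} A} {n t s : ℕ} (hs : t ≤ s)
    (x : Ext.{u} (ModuleCat.of A (A ⧸ J ^ t)) M n) :
    cls J M n s (res (Ideal.pow_le_pow_right hs) x) = cls J M n t x :=
  Module.DirectLimit.of_f (f := transition J M n) (hij := hs)

theorem comp_cls (J : Ideal A) {M N : ModuleCat.{u} A} {k : ℕ} (β : Ext.{u} M N k)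
    {n m : ℕ} (h : n + k = m) (t : ℕ) (x : Ext.{u} (ModuleCat.of A (A ⧸ J ^ t)) M n) :
    comp J β h (cls J M n t x) = cls J N m t (x.comp β h) :=
  Module.DirectLimit.map_apply_of _ _ _

/-- If a class of `H^i_J(A)` represented by an element killed by `u` is zero, and
`rad (J' + uA) = rad (J + uA)`, then the Bockstein homomorphism of `J'` in degree `i` is zero. -/
theorem bockstein_eq_zero [IsNoetherianRing A] {u : A} (hu : u ∈ nonZeroDivisors A)
    {J J' : Ideal A} (hJ : (J' ⊔ Ideal.span {u}).radical = (J ⊔ Ideal.span {u}).radical)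
    {i j : ℕ} (hj : j + 1 = i)
    (hreg : ∀ (t : ℕ) (x : Ext.{u} (ModuleCat.of A (A ⧸ J ^ t)) (ModuleCat.of A A) i),
      u • x = 0 → ∃ (s : ℕ) (hs : t ≤ s), res (Ideal.pow_le_pow_right (I := J) hs) x = 0) :
    bockstein J' u hu hj = 0 := by
  set M := ModuleCat.of A (A ⧸ Ideal.span {u})
  have hM : Module.IsPowTorsion u M := fun m => ⟨1, by
    obtain ⟨m, rfl⟩ := Submodule.Quotient.mk_surjective _ m
    rw [pow_one]
    exact (Submodule.Quotient.mk_eq_zero _).2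
      (Ideal.mul_mem_right m _ (Ideal.mem_span_singleton_self u))⟩
  set K := (J ⊔ Ideal.span {u}).radical with hK
  have hJK : J ≤ K := le_sup_left.trans Ideal.le_radical
  have hJK' : J' ≤ K := by
    rw [← hJ]
    exact le_sup_left.trans Ideal.le_radical
  obtain ⟨a, ha⟩ := Ideal.exists_radical_pow_le_of_fg (J ⊔ Ideal.span {u})
    (IsNoetherian.noetherian _)
  obtain ⟨a', ha'⟩ := Ideal.exists_radical_pow_le_of_fg (J' ⊔ Ideal.span {u})
    (IsNoetherian.noetherian _)
  rw [hJ] at ha'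
  have hX := mulComplex_shortExact hu
  let B : Ext.{u} M M 1 := hX.extClass.comp (Ext.mk₀ (quotMap u)) (add_zero 1)
  have hB : ∀ t x, bockstein J' u hu hj (cls J' M j t x) = cls J' M i t (x.comp B hj) := by
    intro t x
    rw [bockstein, LinearMap.comp_apply, connecting, map, comp_cls, comp_cls,
      Ext.comp_assoc _ _ _ hj (add_zero 1) (by omega)]
  refine LinearMap.ext fun z => ?_
  obtain ⟨t, x, rfl⟩ := exists_cls_eq z
  obtain ⟨s, hs, y, hy⟩ := (res_eventually_bijective hJK' ha' j M hM).1 t x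
  have hx : cls J' M j t x = cls J' M j s (res (Ideal.pow_right_mono hJK' s) y) := by
    rw [hy, cls_res hs]
  let w : Ext.{u} (ModuleCat.of A (A ⧸ J ^ s)) (ModuleCat.of A A) i :=
    (res (Ideal.pow_right_mono hJK s) y).comp hX.extClass hj
  -- Consecutive maps in the long exact sequence: multiplication by `u` follows the connecting map.
  have hw : u • w = 0 := by
    have hf : Ext.mk₀ (u • 𝟙 (ModuleCat.of A A)) = Ext.mk₀ (mulComplex u).f := rfl
    rw [Ext.smul_eq_comp_mk₀, hf, Ext.comp_assoc _ _ _ hj (add_zero 1) (by omega),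
      hX.extClass_comp, Ext.comp_zero]
  obtain ⟨r, hr, hr0⟩ := hreg s w hw
  have hyK : res (Ideal.pow_right_mono hJK r)
      (res (Ideal.pow_le_pow_right (I := K) hr) (y.comp B hj)) = 0 := by
    have : res (Ideal.pow_le_pow_right (I := J) hr) (w.comp (Ext.mk₀ (quotMap u)) (add_zero i)) =
        0 := by
      rw [res_comp, hr0, Ext.zero_comp]
    rw [← this, res_res, Ext.comp_assoc _ _ _ hj (add_zero 1) (by omega), ← res_comp, res_res]
  -- The product of `y` with `B` vanishes after restriction to `J`, so it already vanishes for `K`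
  -- at a later stage, and therefore for `J'`.
  obtain ⟨q, hq, hq0⟩ := (res_eventually_bijective hJK ha i M hM).2 r _ hyK
  rw [hx, hB, LinearMap.zero_apply, cls_eq_zero_iff]
  refine ⟨q, hr.trans hq, ?_⟩
  rw [res_res] at hq0
  rw [← res_comp, res_res, ← res_res (Ideal.pow_right_mono hJK' q)
    (Ideal.pow_le_pow_right (hr.trans hq)), hq0, res_zero]

end DirectLimit

end LocalCohomologyExt

/-! ### Associated primes over `ℤ` and the conclusion. -/

/-- If `(p)` is not an associated prime of an abelian group, then the group has no `p`-torsion. -/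
theorem eq_zero_of_span_notMem_associatedPrimes {M : Type*} [AddCommGroup M] [Module ℤ M] {p : ℕ}
    (hp : p.Prime) (h : Ideal.span {(p : ℤ)} ∉ associatedPrimes ℤ M) {z : M} (hz : p • z = 0) :
    z = 0 := by
  by_contra hz0
  have hpZ : Prime (p : ℤ) := Nat.prime_iff_prime_int.1 hp
  have hprime : (Ideal.span {(p : ℤ)}).IsPrime := (Ideal.span_singleton_prime hpZ.ne_zero).2 hpZ
  have hmax : (Ideal.span {(p : ℤ)}).IsMaximal := hprime.isMaximal (by simpa using hpZ.ne_zero)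
  refine h ⟨hprime, z, ?_⟩
  -- The annihilator of `z` is proper and contains the maximal ideal `(p)`, so it equals `(p)`.
  have hle : Ideal.span {(p : ℤ)} ≤ (⊥ : Submodule ℤ M).colon {z} := by
    rw [Ideal.span_singleton_le_iff_mem, Submodule.mem_colon_singleton, Submodule.mem_bot,
      Nat.cast_smul_eq_nsmul, hz]
  have hne : (⊥ : Submodule ℤ M).colon {z} ≠ ⊤ := fun ht => hz0 <| by
    have : (1 : ℤ) ∈ (⊥ : Submodule ℤ M).colon {z} := ht ▸ trivial
    simpa [Submodule.mem_colon_singleton] using this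
  rw [← hmax.eq_of_le hne hle, hprime.radical]

theorem IsEisensteinExtension.free_and_finite {R S : Type u} [CommRing R] [IsLocalRing R]
    [CommRing S] [Algebra R S] (h : IsEisensteinExtension R S) :
    Module.Free R S ∧ Module.Finite R S := by
  obtain ⟨f, hf, -, -, ⟨e⟩⟩ := h
  have := hf.free_adjoinRoot
  have := hf.finite_adjoinRoot
  exact ⟨.of_equiv e.toLinearEquiv, .equiv e.toLinearEquiv⟩

theorem theorem3p5 (R S : Type u) [CommRing R] [IsRegularLocalRing R] [CharZero R]
    (p : ℕ) (hp : p.Prime) [CharP (IsLocalRing.ResidueField R) p]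
    (hunram : (p : R) ∉ IsLocalRing.maximalIdeal R ^ 2)
    [CommRing S] [Algebra R S] (hS : IsEisensteinExtension R S)
    (I : Ideal R) (i : ℕ)
    (hI : Ideal.span {(p : ℤ)} ∉
      associatedPrimes ℤ (LocalCohomologyExt.H I i (ModuleCat.of R R)) ∪
        associatedPrimes ℤ (LocalCohomologyExt.H I (i + 1) (ModuleCat.of R R))) :
    ∃ hpS : (p : S) ∈ nonZeroDivisors S,
      ∀ J : Ideal S,
        (J ⊔ Ideal.span {(p : S)}).radical =
            (I.map (algebraMap R S) ⊔ Ideal.span {(p : S)}).radical →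
          ∀ (j : ℕ) (hj : j + 1 = i),
            LocalCohomologyExt.bockstein J (p : S) hpS hj = 0 := by
  obtain ⟨_, _⟩ := hS.free_and_finite
  have := IsRegularLocalRing.isDomain R
  have : IsNoetherianRing S := IsNoetherianRing.of_finite R S
  have hpS : (p : S) ∈ nonZeroDivisors S := by
    refine mem_nonZeroDivisors_iff_right.2 fun s hs => ?_
    -- A free module over a domain is torsion-free, and `p ≠ 0` in `R`.
    have h : (p : R) • s = 0 := by
      rw [Nat.cast_smul_eq_nsmul, nsmul_eq_mul, mul_comm, hs]
    exact (smul_eq_zero.1 h).resolve_left (Nat.cast_ne_zero.2 hp.ne_zero)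
  refine ⟨hpS, fun J hJ j hj => LocalCohomologyExt.bockstein_eq_zero hpS hJ hj fun t x hx => ?_⟩
  refine LocalCohomologyExt.res_eventually_eq_zero_of_free (p := p) (fun t x hx => ?_) t x
    (by rwa [← Nat.cast_smul_eq_nsmul S])
  rw [← LocalCohomologyExt.cls_eq_zero_iff]
  refine eq_zero_of_span_notMem_associatedPrimes hp (fun h => hI (Or.inl h)) ?_
  rw [← map_nsmul, hx, map_zero]
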